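/- Let $n\ge 1$ and $0<\theta\le q<\infty$. For $k\in\mathbb Z$ and $m\in\mathbb Z^n$ let $Q_{k,m}=2^{-k}([0,1)^n+m)$, let $\mathcal Q$ be the collection of all these dyadic cubes, and let $l(P)$ be the side length of a cube $P$. A weight is a nonnegative locally integrable function on $\mathbb R^n$ which is positive almost everywhere. Let $\{t_k\}_{k\in\mathbb Z}$ be a sequence of weights with $t_k\in L_q^{\mathrm{loc}}(\mathbb R^n)$ for all $k$, and suppose that there is a constant $C>0$ such that, for all $k\in\mathbb Z$ and all cubes $Q\subset\mathbb R^n$ with sides parallel to the axes, $$\Big(\frac1{|Q|}\int_Q t_k^q\,dx\Big)^{1/q}\Big(\frac1{|Q|}\int_Q t_k^{-\sigma_1}\,dx\Big)^{1/\sigma_1}\le C,\qquad \sigma_1=\theta\Big(\frac q\theta\Big)',$$ where $'$ denotes the conjugate exponent and, if $\theta=q$ (so $\sigma_1=\infty$), the second factor is $\operatorname{ess\,sup}_Q t_k^{-1}$. For a complex sequence $\lambda=\{\lambda_{k,m}\}_{k\in\mathbb Z,m\in\mathbb Z^n}$ put $$\|\lambda|\dot f_{\infty,q}(\mathbb R^n,\{t_k\})\|=\sup_{P\in\mathcal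 Q}\Big(\frac1{|P|}\int_P\sum_{k=-\log_2 l(P)}^\infty\sum_{m\in\mathbb Z^n}2^{knq/2}t_k^q(x)|\lambda_{k,m}|^q\chi_{Q_{k,m}}(x)\,dx\Big)^{1/q},$$ and say that $\lambda\in\dot f_{\infty,q}(\mathbb R^n,\{t_k\})$ if this is finite. Fix $0<\varepsilon<1$ (for instance $\varepsilon=\tfrac12$). Then $\lambda\in\dot f_{\infty,q}(\mathbb R^n,\{t_k\})$ if and only if for each dyadic cube $Q_{k,m}$ there is a measurable subset $E_{Q_{k,m}}\subset Q_{k,m}$ with $|E_{Q_{k,m}}|>\varepsilon|Q_{k,m}|$ such that $$\Big\|\Big(\sum_{k=-\infty}^{\infty}\sum_{m\in\mathbb Z^n}2^{knq/2}t_k^q|\lambda_{k,m}|^q\chi_{E_{Q_{k,m}}}\Big)^{1/q}\Big|L_\infty(\mathbb R^n)\Big\|<\infty.$$ Moreover, there are constants $c_1,c_2>0$, independent of $\lambda$, such that for every $\lambda$ the infimum of this expression over all such collections $\{E_{Q_{k,m}}\}$ lies between $c_1\|\lambda|\dot f_{\infty,q}(\mathbb R^n,\{t_k\})\|$ and $c_2\|\lambda|\dot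 f_{\infty,q}(\mathbb R^n,\{t_k\})\|$. -/

import Mathlib

open MeasureTheory Set
open scoped ENNReal

namespace WeightedTL

/-- The half-open cube in `ℝⁿ` with sides parallel to the axes, lower corner `a` and
side length `r`. (The space `Fin n → ℝ` is used with its Lebesgue measure; no norm on it
enters anywhere below.) -/
def cube {n : ℕ} (a : Fin n → ℝ) (r : ℝ) : Set (Fin n → ℝ) :=
  Set.univ.pi fun i => Set.Ico (a i) (a i + r)

/-- The dyadic cube `Q_{k,m} = 2^{-k} ([0,1)ⁿ + m)`. -/
def dyadicCube {n : ℕ} (k : ℤ) (m : Fin n → ℤ) : Set (Fin n → ℝ) :=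
  cube (fun i => (2 : ℝ) ^ (-k) * (m i : ℝ)) ((2 : ℝ) ^ (-k))

/-- The mean `M_{Q,p}(f) = (|Q|⁻¹ ∫_Q |f|^p)^{1/p}` for `0 < p < ∞`, and the essential supremum
of `|f|` over `Q` for `p = ∞`. -/
noncomputable def mean {n : ℕ} (Q : Set (Fin n → ℝ)) (p : ℝ≥0∞) (f : (Fin n → ℝ) → ℝ) : ℝ≥0∞ :=
  eLpNorm f p ((volume Q)⁻¹ • volume.restrict Q)

/-- A weight: a nonnegative locally integrable function, positive almost everywhere. -/
structure IsWeight {n : ℕ} (w : (Fin n → ℝ) → ℝ) : Prop where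
  nonneg : ∀ x, 0 ≤ w x
  locallyIntegrable : LocallyIntegrable w volume
  ae_pos : ∀ᵐ x ∂volume, 0 < w x

/-- A `q`-admissible weight sequence `{t_k}_{k ∈ ℤ}`: every `t_k` is a weight that belongs to
`L_q` on every compact set. -/
structure IsAdmissible {n : ℕ} (q : ℝ) (t : ℤ → (Fin n → ℝ) → ℝ) : Prop where
  weight : ∀ k, IsWeight (t k)
  memLp_loc : ∀ k, ∀ K : Set (Fin n → ℝ), IsCompact K →
    MemLp (t k) (ENNReal.ofReal q) (volume.restrict K)

/-- The exponent `θ (q/θ)'`, where `'` denotes the conjugate exponent; it is `∞` if `θ = q`. -/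
noncomputable def sigmaOne (θ q : ℝ) : ℝ≥0∞ :=
  ENNReal.ofReal θ * ENNReal.conjExponent (ENNReal.ofReal (q / θ))

/-- There is a constant `C > 0` with `M_{Q,p}(t_k) M_{Q,σ}(t_k⁻¹) ≤ C` for all `k ∈ ℤ` and
all cubes `Q`. -/
def DiagonalCondition {n : ℕ} (p σ : ℝ≥0∞) (t : ℤ → (Fin n → ℝ) → ℝ) : Prop :=
  ∃ C : ℝ, 0 < C ∧ ∀ (k : ℤ) (a : Fin n → ℝ) (r : ℝ), 0 < r →
    mean (cube a r) p (t k) * mean (cube a r) σ (fun x => (t k x)⁻¹) ≤ ENNReal.ofReal C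

/-- The `k`-th level sum `∑_{m ∈ ℤⁿ} 2^{knq/2} t_k(x)^q |λ_{k,m}|^q χ_{E_{k,m}}(x)`. -/
noncomputable def levelSum {n : ℕ} (q : ℝ) (t : ℤ → (Fin n → ℝ) → ℝ)
    (lam : ℤ → (Fin n → ℤ) → ℂ) (E : ℤ → (Fin n → ℤ) → Set (Fin n → ℝ))
    (k : ℤ) (x : Fin n → ℝ) : ℝ≥0∞ :=
  ∑' m : Fin n → ℤ, (E k m).indicator
    (fun y => ENNReal.ofReal ((2 : ℝ) ^ ((k : ℝ) * n * q / 2) * t k y ^ q * ‖lam k m‖ ^ q)) x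

/-- The quasi-norm of `λ` in the sequence space `ḟ_{∞,q}(ℝⁿ, {t_k})`, with values in `[0,∞]`:
the supremum over all dyadic cubes `P = Q_{j,l}` (so that `-log₂ l(P) = j`) of
`(|P|⁻¹ ∫_P ∑_{k ≥ j} ∑_m 2^{knq/2} t_k^q |λ_{k,m}|^q χ_{Q_{k,m}} dx)^{1/q}`. -/
noncomputable def fInftyNorm {n : ℕ} (q : ℝ) (t : ℤ → (Fin n → ℝ) → ℝ)
    (lam : ℤ → (Fin n → ℤ) → ℂ) : ℝ≥0∞ :=
  ⨆ (j : ℤ) (l : Fin n → ℤ),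
    ((volume (dyadicCube j l))⁻¹ * ∫⁻ x in dyadicCube j l,
      ∑' k : Set.Ici j, levelSum q t lam dyadicCube k x) ^ (1 / q)

/-- The sequence space `ḟ_{∞,q}(ℝⁿ, {t_k})`. -/
def fInfty {n : ℕ} (q : ℝ) (t : ℤ → (Fin n → ℝ) → ℝ) : Set (ℤ → (Fin n → ℤ) → ℂ) :=
  {lam | fInftyNorm q t lam < ∞}

/-- Collections `{E_{k,m}}` of (Lebesgue) measurable sets `E_{k,m} ⊆ Q_{k,m}` with
`|E_{k,m}| > ε |Q_{k,m}|`. -/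
def subsetCollections (n : ℕ) (ε : ℝ) : Set (ℤ → (Fin n → ℤ) → Set (Fin n → ℝ)) :=
  {E | ∀ k m, NullMeasurableSet (E k m) volume ∧ E k m ⊆ dyadicCube k m ∧
    ENNReal.ofReal ε * volume (dyadicCube k m) < volume (E k m)}

/-- The `L_∞(ℝⁿ)` norm of `(∑_k ∑_m 2^{knq/2} t_k^q |λ_{k,m}|^q χ_{E_{k,m}})^{1/q}`, with values
in `[0,∞]`. -/
noncomputable def collectionNorm {n : ℕ} (q : ℝ) (t : ℤ → (Fin n → ℝ) → ℝ)
    (lam : ℤ → (Fin n → ℤ) → ℂ) (E : ℤ → (Fin n → ℤ) → Set (Fin n → ℝ)) : ℝ≥0∞ :=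
  essSup (fun x => (∑' k : ℤ, levelSum q t lam E k x) ^ (1 / q)) volume

end WeightedTL

namespace WeightedTL

variable {n : ℕ} {θ q ε : ℝ} {t : ℤ → (Fin n → ℝ) → ℝ}

/-! Lower bound: since 1/θ = 1/q + 1/σ₁, Hölder applied to χ_E = (χ_E t_k) · t_k⁻¹ on a cube,
combined with the weight condition, shows that a subset of proportion ε carries a fixed share of ∫
t_k^q. By nesting, replacing each Q_{k,m} by E_{k,m} costs only a constant in the integral over P,
and the remaining integrand is bounded by the essential supremum (`lintegral_cube_le`,
`lintegral_levelSum_le`). Upper bound: let E_{k,m} be the part of Q_{k,m} where the sum over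
generations ≥ k is at most K‖λ‖^q. Chebyshev makes it large; at each point, the coarsest
contributing generation bounds all finer ones (`sublevel_mem_subsetCollections`,
`tsum_levelSum_sublevel_le`). -/

/-! ### Dyadic cubes and their nesting. -/

theorem measurableSet_cube (a : Fin n → ℝ) (r : ℝ) : MeasurableSet (cube a r) :=
  MeasurableSet.univ_pi fun _ => measurableSet_Ico

theorem measurableSet_dyadicCube (k : ℤ) (m : Fin n → ℤ) : MeasurableSet (dyadicCube k m) :=
  measurableSet_cube _ _

theorem volume_cube_ne_top (a : Fin n → ℝ) (r : ℝ) : volume (cube a r) ≠ ∞ := by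
  rw [cube, volume_pi_pi]
  exact ENNReal.prod_ne_top fun i _ => by simp

theorem volume_cube_ne_zero (a : Fin n → ℝ) {r : ℝ} (hr : 0 < r) : volume (cube a r) ≠ 0 := by
  rw [cube, volume_pi_pi, Finset.prod_ne_zero_iff]
  intro i _
  simpa using hr

theorem volume_dyadicCube_ne_top (k : ℤ) (m : Fin n → ℤ) : volume (dyadicCube k m) ≠ ∞ :=
  volume_cube_ne_top _ _

theorem volume_dyadicCube_ne_zero (k : ℤ) (m : Fin n → ℤ) : volume (dyadicCube k m) ≠ 0 :=
  volume_cube_ne_zero _ (by positivity)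

/-- A dyadic cube that meets a larger dyadic cube is contained in it. -/
theorem dyadicCube_subset_of_mem {j k : ℤ} (hjk : j ≤ k) {l m : Fin n → ℤ} {x : Fin n → ℝ}
    (hxk : x ∈ dyadicCube k m) (hxj : x ∈ dyadicCube j l) : dyadicCube k m ⊆ dyadicCube j l := by
  intro y hy i hi
  obtain ⟨N, hN⟩ := Int.eq_ofNat_of_zero_le (sub_nonneg.2 hjk)
  have hpow : (2 : ℝ) ^ (-j) = (2 : ℝ) ^ (-k) * ((2 ^ N : ℤ) : ℝ) := by
    have : -j = -k + (N : ℤ) := by omega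
    rw [this, zpow_add₀ two_ne_zero, zpow_natCast]
    push_cast
    rfl
  have hpos : (0 : ℝ) < (2 : ℝ) ^ (-k) := by positivity
  obtain ⟨h1, h2⟩ := hxk i hi
  obtain ⟨h3, h4⟩ := hxj i hi
  obtain ⟨h5, h6⟩ := hy i hi
  simp only [hpow] at h3 h4 ⊢
  generalize (2 : ℝ) ^ (-k) = d at *
  -- In units of the smaller side all corners are integers, so strict overlap inequalities sharpen
  -- to containment.
  have ha : (2 ^ N : ℤ) * l i < m i + 1 := by
    have : d * (((2 ^ N : ℤ) * l i : ℤ) : ℝ) < d * ((m i + 1 : ℤ) : ℝ) := by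
      push_cast at *
      linarith
    exact_mod_cast lt_of_mul_lt_mul_left this hpos.le
  have hb : m i < (2 ^ N : ℤ) * (l i + 1) := by
    have : d * ((m i : ℤ) : ℝ) < d * (((2 ^ N : ℤ) * (l i + 1) : ℤ) : ℝ) := by
      push_cast at *
      linarith
    exact_mod_cast lt_of_mul_lt_mul_left this hpos.le
  have ha' : d * (((2 ^ N : ℤ) * l i : ℤ) : ℝ) ≤ d * (m i : ℝ) :=
    mul_le_mul_of_nonneg_left (by exact_mod_cast Int.lt_add_one_iff.1 ha) hpos.le
  have hb' : d * ((m i + 1 : ℤ) : ℝ) ≤ d * (((2 ^ N : ℤ) * (l i + 1) : ℤ) : ℝ) :=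
    mul_le_mul_of_nonneg_left (by exact_mod_cast hb) hpos.le
  push_cast at *
  constructor <;> linarith

/-! ### The weight condition on large subsets. -/

/-- Divide 1/(q/θ) + 1/(q/θ)' = 1 by θ; in `ℝ≥0∞` this includes θ = q, where σ₁ = ∞. -/
theorem holderTriple_sigmaOne (hθ : 0 < θ) (hθq : θ ≤ q) :
    ENNReal.HolderTriple (ENNReal.ofReal q) (sigmaOne θ q) (ENNReal.ofReal θ) := by
  have hq : 0 < q := hθ.trans_le hθq
  have hone : 1 ≤ ENNReal.ofReal (q / θ) := by
    rw [ENNReal.one_le_ofReal]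
    exact (one_le_div hθ).2 hθq
  have hc : ENNReal.HolderConjugate (ENNReal.ofReal (q / θ))
      (ENNReal.conjExponent (ENNReal.ofReal (q / θ))) := ENNReal.HolderConjugate.conjExponent hone
  have hθ0 : ENNReal.ofReal θ ≠ 0 := by simpa using hθ
  have h := hc.inv_add_inv_eq_inv
  refine ⟨?_⟩
  have e : ENNReal.ofReal q = ENNReal.ofReal θ * ENNReal.ofReal (q / θ) := by
    rw [← ENNReal.ofReal_mul hθ.le, mul_div_cancel₀ _ hθ.ne']
  rw [sigmaOne, e, ENNReal.mul_inv (Or.inl hθ0) (Or.inl ENNReal.ofReal_ne_top),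
    ENNReal.mul_inv (Or.inl hθ0) (Or.inl ENNReal.ofReal_ne_top), ← mul_add, h]
  simp

theorem IsAdmissible.aemeasurable (ht : IsAdmissible q t) (k : ℤ) : AEMeasurable (t k) volume :=
  (ht.weight k).locallyIntegrable.aestronglyMeasurable.aemeasurable

/-- A set that fills a fixed proportion of a cube carries a fixed proportion of the weight. -/
theorem lintegral_cube_le (hθ : 0 < θ) (hθq : θ ≤ q) (ht : IsAdmissible q t) (hε0 : 0 < ε)
    {C : ℝ} (hC : 0 < C) (hA : ∀ (k : ℤ) (a : Fin n → ℝ) (r : ℝ), 0 < r →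
      mean (cube a r) (ENNReal.ofReal q) (t k) *
        mean (cube a r) (sigmaOne θ q) (fun x => (t k x)⁻¹) ≤ ENNReal.ofReal C)
    (k : ℤ) (a : Fin n → ℝ) {r : ℝ} (hr : 0 < r) {E : Set (Fin n → ℝ)}
    (hEm : NullMeasurableSet E volume) (hE : E ⊆ cube a r)
    (hEv : ENNReal.ofReal ε * volume (cube a r) < volume E) :
    ∫⁻ x in cube a r, ENNReal.ofReal (t k x ^ q) ≤
      ENNReal.ofReal ((C * ε ^ (-(1 / θ))) ^ q) * ∫⁻ x in E, ENNReal.ofReal (t k x ^ q) := by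
  have hq : 0 < q := hθ.trans_le hθq
  set Q := cube a r
  have hQ0 : volume Q ≠ 0 := volume_cube_ne_zero a hr
  have hQt : volume Q ≠ ∞ := volume_cube_ne_top a r
  set μ : Measure (Fin n → ℝ) := (volume Q)⁻¹ • volume.restrict Q with hμ
  have hac : μ ≪ volume :=
    (Measure.smul_absolutelyContinuous).trans Measure.restrict_le_self.absolutelyContinuous
  have htm : AEStronglyMeasurable (t k) μ := ((ht.aemeasurable k).mono_ac hac).aestronglyMeasurable
  have hpos : ∀ᵐ x ∂μ, 0 < t k x := hac.ae_le (ht.weight k).ae_pos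
  have hEμ : NullMeasurableSet E μ := hEm.mono_ac hac
  have hmE : ENNReal.ofReal ε ≤ μ E := by
    have : μ E = (volume Q)⁻¹ * volume E := by
      rw [hμ, Measure.smul_apply, smul_eq_mul, Measure.restrict_eq_self _ hE]
    rw [this, mul_comm, ← div_eq_mul_inv]
    exact (ENNReal.le_div_iff_mul_le (Or.inl hQ0) (Or.inl hQt)).2 hEv.le
  have hholder := holderTriple_sigmaOne hθ hθq
  have h1 : eLpNorm (E.indicator (fun _ => (1 : ℝ))) (ENNReal.ofReal θ) μ ≤
      eLpNorm (E.indicator (t k)) (ENNReal.ofReal q) μ *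
        eLpNorm (fun x => (t k x)⁻¹) (sigmaOne θ q) μ := by
    have hH := eLpNorm_smul_le_mul_eLpNorm (p := ENNReal.ofReal q) (q := sigmaOne θ q)
      (r := ENNReal.ofReal θ) (f := fun x => (t k x)⁻¹) (φ := E.indicator (t k)) (μ := μ)
      htm.aemeasurable.inv.aestronglyMeasurable (htm.indicator₀ hEμ)
    -- The factorisation of χ_E needs t_k ≠ 0, hence holds only almost everywhere.
    refine le_trans (le_of_eq (eLpNorm_congr_ae ?_)) hH
    filter_upwards [hpos] with x hx
    by_cases hxE : x ∈ E <;> simp [hxE, hx.ne']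
  have h2 : ENNReal.ofReal ε ^ (1 / θ) ≤
      eLpNorm (E.indicator (fun _ => (1 : ℝ))) (ENNReal.ofReal θ) μ := by
    rw [eLpNorm_indicator_const₀ hEμ (by simpa using hθ) ENNReal.ofReal_ne_top,
      ENNReal.toReal_ofReal hθ.le]
    simpa using ENNReal.rpow_le_rpow hmE (by positivity : (0 : ℝ) ≤ θ⁻¹)
  -- Multiplying by the mean of t_k, rather than dividing by that of t_k⁻¹, produces the product
  -- bounded by C.
  have h3 : ENNReal.ofReal ε ^ (1 / θ) * eLpNorm (t k) (ENNReal.ofReal q) μ ≤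
      ENNReal.ofReal C * eLpNorm (E.indicator (t k)) (ENNReal.ofReal q) μ := by
    calc _ ≤ (eLpNorm (E.indicator (t k)) (ENNReal.ofReal q) μ *
        eLpNorm (fun x => (t k x)⁻¹) (sigmaOne θ q) μ) * eLpNorm (t k) (ENNReal.ofReal q) μ := by
          gcongr
          exact h2.trans h1
      _ = (eLpNorm (t k) (ENNReal.ofReal q) μ * eLpNorm (fun x => (t k x)⁻¹) (sigmaOne θ q) μ) *
          eLpNorm (E.indicator (t k)) (ENNReal.ofReal q) μ := by ring
      _ ≤ _ := by
          gcongr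
          exact hA k a r hr
  have h4 : eLpNorm (t k) (ENNReal.ofReal q) μ ≤ ENNReal.ofReal (C * ε ^ (-(1 / θ))) *
      eLpNorm (E.indicator (t k)) (ENNReal.ofReal q) μ := by
    rw [ENNReal.ofReal_rpow_of_pos hε0] at h3
    have hmul : ENNReal.ofReal (ε ^ (-(1 / θ))) * ENNReal.ofReal (ε ^ (1 / θ)) = 1 := by
      rw [← ENNReal.ofReal_mul (by positivity), ← Real.rpow_add hε0]
      simp
    calc _ = ENNReal.ofReal (ε ^ (-(1 / θ))) *
          (ENNReal.ofReal (ε ^ (1 / θ)) * eLpNorm (t k) (ENNReal.ofReal q) μ) := by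
          rw [← mul_assoc, hmul, one_mul]
      _ ≤ ENNReal.ofReal (ε ^ (-(1 / θ))) * (ENNReal.ofReal C * _) := by gcongr
      _ = _ := by rw [ENNReal.ofReal_mul hC.le]; ring
  have hpow : ∀ f : (Fin n → ℝ) → ℝ, eLpNorm f (ENNReal.ofReal q) μ ^ q =
      (volume Q)⁻¹ * ∫⁻ x in Q, ‖f x‖ₑ ^ q := by
    intro f
    rw [eLpNorm_eq_lintegral_rpow_enorm_toReal (by simpa using hq) ENNReal.ofReal_ne_top,
      ENNReal.toReal_ofReal hq.le, ← ENNReal.rpow_mul, one_div, inv_mul_cancel₀ hq.ne',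
      ENNReal.rpow_one, hμ, lintegral_smul_measure, smul_eq_mul]
  have hnorm : ∀ x, ‖t k x‖ₑ ^ q = ENNReal.ofReal (t k x ^ q) := by
    intro x
    rw [Real.enorm_of_nonneg ((ht.weight k).nonneg x),
      ENNReal.ofReal_rpow_of_nonneg ((ht.weight k).nonneg x) hq.le]
  have h5 := ENNReal.rpow_le_rpow h4 hq.le
  rw [ENNReal.mul_rpow_of_nonneg _ _ hq.le, hpow, hpow,
    ENNReal.ofReal_rpow_of_nonneg (by positivity) hq.le] at h5
  have hind : ∫⁻ x in Q, ‖E.indicator (t k) x‖ₑ ^ q = ∫⁻ x in E, ENNReal.ofReal (t k x ^ q) := by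
    have : ∀ x, ‖E.indicator (t k) x‖ₑ ^ q =
        E.indicator (fun x => ENNReal.ofReal (t k x ^ q)) x := by
      intro x
      by_cases hx : x ∈ E
      · simp [hx, hnorm]
      · simp [hx, hq]
    simp_rw [this]
    rw [lintegral_indicator₀ (hEm.mono_ac Measure.restrict_le_self.absolutelyContinuous),
      Measure.restrict_restrict₀ (hEm.mono_ac Measure.restrict_le_self.absolutelyContinuous),
      inter_eq_left.2 hE]
  simp_rw [hnorm] at h5
  rw [hind, mul_left_comm] at h5
  exact (ENNReal.mul_le_mul_iff_right (ENNReal.inv_ne_zero.2 hQt)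
    (ENNReal.inv_ne_top.2 hQ0)).1 h5

/-! ### Lower bound: from cubes to subsets. -/

theorem IsAdmissible.aemeasurable_term (ht : IsAdmissible q t) (k : ℤ) (c d : ℝ) :
    AEMeasurable (fun y => ENNReal.ofReal (c * t k y ^ q * d)) volume :=
  ((((ht.aemeasurable k).pow_const q).const_mul c).mul_const d).ennreal_ofReal

theorem IsAdmissible.aemeasurable_levelSum (ht : IsAdmissible q t) (lam : ℤ → (Fin n → ℤ) → ℂ)
    {E : ℤ → (Fin n → ℤ) → Set (Fin n → ℝ)} (hE : ∀ k m, NullMeasurableSet (E k m) volume)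
    (k : ℤ) : AEMeasurable (levelSum q t lam E k) volume :=
  AEMeasurable.tsum fun m => (ht.aemeasurable_term k _ _).indicator₀ (hE k m)

/-- On a dyadic cube of generation at most `k`, passing from the cubes of generation `k` to large
subsets of them changes the integral of the level sum by a bounded factor only. -/
theorem lintegral_levelSum_le (ht : IsAdmissible q t) {D : ℝ≥0∞}
    {lam : ℤ → (Fin n → ℤ) → ℂ} {E : ℤ → (Fin n → ℤ) → Set (Fin n → ℝ)}
    (hEm : ∀ k m, NullMeasurableSet (E k m) volume) (hE : ∀ k m, E k m ⊆ dyadicCube k m)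
    (hD : ∀ k m, ∫⁻ x in dyadicCube k m, ENNReal.ofReal (t k x ^ q) ≤
      D * ∫⁻ x in E k m, ENNReal.ofReal (t k x ^ q))
    {j k : ℤ} (hjk : j ≤ k) (l : Fin n → ℤ) :
    ∫⁻ x in dyadicCube j l, levelSum q t lam dyadicCube k x ≤
      D * ∫⁻ x in dyadicCube j l, levelSum q t lam E k x := by
  have hres : ∀ {s : Set (Fin n → ℝ)}, NullMeasurableSet s volume →
      NullMeasurableSet s (volume.restrict (dyadicCube j l)) :=
    fun hs => hs.mono_ac Measure.restrict_le_self.absolutelyContinuous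
  have hQ : ∀ k m, NullMeasurableSet (dyadicCube (n := n) k m) volume :=
    fun k m => (measurableSet_dyadicCube k m).nullMeasurableSet
  simp only [levelSum]
  rw [lintegral_tsum fun m => ((ht.aemeasurable_term k _ _).indicator₀ (hQ k m)).restrict,
    lintegral_tsum fun m => ((ht.aemeasurable_term k _ _).indicator₀ (hEm k m)).restrict,
    ← ENNReal.tsum_mul_left]
  refine ENNReal.tsum_le_tsum fun m => ?_
  rw [lintegral_indicator₀ (hres (hQ k m)), lintegral_indicator₀ (hres (hEm k m)),
    Measure.restrict_restrict₀ (hres (hQ k m)), Measure.restrict_restrict₀ (hres (hEm k m))]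
  -- Cubes missing Q_{j,l} contribute nothing; the others lie inside it because j ≤ k.
  rcases (dyadicCube k m ∩ dyadicCube j l).eq_empty_or_nonempty with h | ⟨x, hxk, hxj⟩
  · simp [h]
  have hsub := dyadicCube_subset_of_mem hjk hxk hxj
  rw [inter_eq_left.2 hsub, inter_eq_left.2 ((hE k m).trans hsub)]
  have hterm : ∀ y, ENNReal.ofReal ((2 : ℝ) ^ ((k : ℝ) * n * q / 2) * t k y ^ q * ‖lam k m‖ ^ q) =
      ENNReal.ofReal ((2 : ℝ) ^ ((k : ℝ) * n * q / 2) * ‖lam k m‖ ^ q) *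
        ENNReal.ofReal (t k y ^ q) := by
    intro y
    rw [← ENNReal.ofReal_mul (by positivity)]
    ring_nf
  simp_rw [hterm]
  rw [lintegral_const_mul' _ _ ENNReal.ofReal_ne_top,
    lintegral_const_mul' _ _ ENNReal.ofReal_ne_top, mul_left_comm]
  gcongr
  exact hD k m

/-- The norm of the sequence space is controlled by the norm of any collection. -/
theorem fInftyNorm_le_mul_collectionNorm (hq : 0 < q) (ht : IsAdmissible q t) {M : ℝ} (hM : 0 < M)
    {lam : ℤ → (Fin n → ℤ) → ℂ} {E : ℤ → (Fin n → ℤ) → Set (Fin n → ℝ)}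
    (hEm : ∀ k m, NullMeasurableSet (E k m) volume) (hE : ∀ k m, E k m ⊆ dyadicCube k m)
    (hD : ∀ k m, ∫⁻ x in dyadicCube k m, ENNReal.ofReal (t k x ^ q) ≤
      ENNReal.ofReal (M ^ q) * ∫⁻ x in E k m, ENNReal.ofReal (t k x ^ q)) :
    fInftyNorm q t lam ≤ ENNReal.ofReal M * collectionNorm q t lam E := by
  have hQ : ∀ k m, NullMeasurableSet (dyadicCube (n := n) k m) volume :=
    fun k m => (measurableSet_dyadicCube k m).nullMeasurableSet
  refine iSup₂_le fun j l => ?_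
  rw [one_div, ENNReal.rpow_inv_le_iff hq, ENNReal.mul_rpow_of_nonneg _ _ hq.le,
    ENNReal.ofReal_rpow_of_pos hM]
  have hbound : ∀ᵐ x ∂volume.restrict (dyadicCube j l),
      ∑' k : ℤ, levelSum q t lam E k x ≤ collectionNorm q t lam E ^ q := by
    refine ae_restrict_of_ae ?_
    filter_upwards [ENNReal.ae_le_essSup (μ := volume)
      fun x => (∑' k : ℤ, levelSum q t lam E k x) ^ (1 / q)] with x hx
    exact (ENNReal.rpow_inv_le_iff hq).1 (by simpa only [one_div, collectionNorm] using hx)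
  calc (volume (dyadicCube j l))⁻¹ * ∫⁻ x in dyadicCube j l,
        ∑' k : Set.Ici j, levelSum q t lam dyadicCube k x
      = (volume (dyadicCube j l))⁻¹ * ∑' k : Set.Ici j, ∫⁻ x in dyadicCube j l,
          levelSum q t lam dyadicCube k x := by
        rw [lintegral_tsum fun k : Set.Ici j => (ht.aemeasurable_levelSum lam hQ k).restrict]
    _ ≤ (volume (dyadicCube j l))⁻¹ * ∑' k : Set.Ici j, ENNReal.ofReal (M ^ q) *
          ∫⁻ x in dyadicCube j l, levelSum q t lam E k x := by
        gcongr with k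
        exact lintegral_levelSum_le ht hEm hE hD k.2 l
    _ = (volume (dyadicCube j l))⁻¹ * (ENNReal.ofReal (M ^ q) * ∫⁻ x in dyadicCube j l,
          ∑' k : Set.Ici j, levelSum q t lam E k x) := by
        rw [lintegral_tsum fun k : Set.Ici j => (ht.aemeasurable_levelSum lam hEm k).restrict,
          ENNReal.tsum_mul_left]
    _ ≤ (volume (dyadicCube j l))⁻¹ * (ENNReal.ofReal (M ^ q) * ∫⁻ _ in dyadicCube j l,
          collectionNorm q t lam E ^ q) := by
        gcongr 2
        refine lintegral_mono_ae (hbound.mono fun x hx => le_trans ?_ hx)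
        exact ENNReal.tsum_comp_le_tsum_of_injective Subtype.val_injective _
    _ = ENNReal.ofReal (M ^ q) * collectionNorm q t lam E ^ q *
          ((volume (dyadicCube j l))⁻¹ * volume (dyadicCube j l)) := by
        rw [setLIntegral_const]
        ring
    _ = ENNReal.ofReal (M ^ q) * collectionNorm q t lam E ^ q := by
        rw [ENNReal.inv_mul_cancel (volume_dyadicCube_ne_zero j l) (volume_dyadicCube_ne_top j l),
          mul_one]

/-! ### Upper bound: sublevel sets of the tail sums. -/

/-- The part of `Q_{k,m}` where the sum over all generations from `k` on is at most `B`. -/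
def sublevel (q : ℝ) (t : ℤ → (Fin n → ℝ) → ℝ) (lam : ℤ → (Fin n → ℤ) → ℂ) (B : ℝ≥0∞)
    (k : ℤ) (m : Fin n → ℤ) : Set (Fin n → ℝ) :=
  dyadicCube k m ∩ {x | ∑' i : Set.Ici k, levelSum q t lam dyadicCube i x ≤ B}

/-- Infinitely many coarse generations may contribute at x, so there need be no coarsest one; each
finite partial sum has one, and its tail, at most B there, dominates that sum. -/
theorem tsum_levelSum_sublevel_le (lam : ℤ → (Fin n → ℤ) → ℂ) (B : ℝ≥0∞) (x : Fin n → ℝ) :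
    ∑' k : ℤ, levelSum q t lam (sublevel q t lam B) k x ≤ B := by
  classical
  rw [ENNReal.tsum_eq_iSup_sum]
  refine iSup_le fun s => ?_
  have hzero : ∀ k, (¬ ∃ m, x ∈ sublevel q t lam B k m) →
      levelSum q t lam (sublevel q t lam B) k x = 0 := by
    intro k hk
    push Not at hk
    exact ENNReal.tsum_eq_zero.2 fun m => indicator_of_notMem (hk m) _
  have hle : ∀ k, levelSum q t lam (sublevel q t lam B) k x ≤ levelSum q t lam dyadicCube k x :=
    fun k => ENNReal.tsum_le_tsum fun m =>
      indicator_le_indicator_of_subset inter_subset_left (fun _ => zero_le) x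
  rw [← Finset.sum_filter_of_ne (p := fun k => ∃ m, x ∈ sublevel q t lam B k m)
    fun k _ hk => by_contra fun h => hk (hzero k h)]
  set S := s.filter fun k => ∃ m, x ∈ sublevel q t lam B k m
  rcases S.eq_empty_or_nonempty with h | h
  · simp [h]
  obtain ⟨m, -, hm⟩ := (Finset.mem_filter.1 (S.min'_mem h)).2
  calc ∑ k ∈ S, levelSum q t lam (sublevel q t lam B) k x
      ≤ ∑ k ∈ S, levelSum q t lam dyadicCube k x := Finset.sum_le_sum fun k _ => hle k
    _ = ∑ k ∈ S, (Set.Ici (S.min' h)).indicator (fun k => levelSum q t lam dyadicCube k x) k :=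
        Finset.sum_congr rfl fun k hk =>
          (indicator_of_mem (Set.mem_Ici.2 (S.min'_le k hk))
            fun k => levelSum q t lam dyadicCube k x).symm
    _ ≤ ∑' k, (Set.Ici (S.min' h)).indicator (fun k => levelSum q t lam dyadicCube k x) k :=
        ENNReal.sum_le_tsum S
    _ = ∑' k : Set.Ici (S.min' h), levelSum q t lam dyadicCube k x :=
        (tsum_subtype (Set.Ici (S.min' h)) fun k => levelSum q t lam dyadicCube k x).symm
    _ ≤ B := hm

theorem lintegral_tail_le (hq : 0 < q) (lam : ℤ → (Fin n → ℤ) → ℂ) (k : ℤ) (m : Fin n → ℤ) :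
    ∫⁻ x in dyadicCube k m, ∑' i : Set.Ici k, levelSum q t lam dyadicCube i x ≤
      volume (dyadicCube k m) * fInftyNorm q t lam ^ q := by
  have h : ((volume (dyadicCube k m))⁻¹ * ∫⁻ x in dyadicCube k m,
      ∑' i : Set.Ici k, levelSum q t lam dyadicCube i x) ^ (1 / q) ≤ fInftyNorm q t lam :=
    le_iSup₂_of_le k m le_rfl
  rw [one_div, ENNReal.rpow_inv_le_iff hq, mul_comm, ← div_eq_mul_inv,
    ENNReal.div_le_iff (volume_dyadicCube_ne_zero k m) (volume_dyadicCube_ne_top k m)] at h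
  rwa [mul_comm]

/-- If `K > 1 / (1 - ε)`, the sublevel sets at height `K ‖λ‖^q` fill more than the proportion
`ε` of the dyadic cubes. -/
theorem sublevel_mem_subsetCollections (hq : 0 < q) (ht : IsAdmissible q t) (hε0 : 0 < ε)
    {lam : ℤ → (Fin n → ℤ) → ℂ} (hlam : fInftyNorm q t lam ≠ ∞) {K : ℝ} (hK : 0 < K)
    (hK1 : 1 < K * (1 - ε)) :
    sublevel q t lam (ENNReal.ofReal K * fInftyNorm q t lam ^ q) ∈ subsetCollections n ε := by
  intro k m
  set A := fInftyNorm q t lam ^ q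
  have hAt : A ≠ ∞ := ENNReal.rpow_ne_top_of_nonneg hq.le hlam
  set G : (Fin n → ℝ) → ℝ≥0∞ := fun x => ∑' i : Set.Ici k, levelSum q t lam dyadicCube i x
  set Q := dyadicCube k m with hQdef
  have hQ0 : volume Q ≠ 0 := volume_dyadicCube_ne_zero k m
  have hQt : volume Q ≠ ∞ := volume_dyadicCube_ne_top k m
  have hGm : AEMeasurable G volume := AEMeasurable.tsum fun i =>
    ht.aemeasurable_levelSum lam (fun k m => (measurableSet_dyadicCube k m).nullMeasurableSet) i
  have hGnull : NullMeasurableSet {x | G x ≤ ENNReal.ofReal K * A} volume :=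
    nullMeasurableSet_le hGm aemeasurable_const
  have hint : ∫⁻ x in Q, G x ≤ volume Q * A := lintegral_tail_le hq lam k m
  have hcheb : ENNReal.ofReal K * volume (Q \ {x | G x ≤ ENNReal.ofReal K * A}) ≤ volume Q := by
    have hset : volume (Q \ {x | G x ≤ ENNReal.ofReal K * A}) =
        volume.restrict Q {x | ENNReal.ofReal K * A < G x} := by
      rw [Measure.restrict_apply' (measurableSet_dyadicCube k m), inter_comm]
      congr 1
      ext x
      simp [hQdef]
    rw [hset]
    -- Chebyshev's inequality must be divided by A; if A = 0, the tail sum vanishes almost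
    -- everywhere on Q.
    rcases eq_or_ne A 0 with h0 | h0
    · have hz : ∫⁻ x in Q, G x = 0 := by simpa [h0] using hint
      have hz' : ∀ᵐ x ∂volume.restrict Q, ¬ ENNReal.ofReal K * A < G x := by
        filter_upwards [(lintegral_eq_zero_iff' hGm.restrict).1 hz] with x hx
        simp [hx]
      have := ae_iff.1 hz'
      simp only [not_not] at this
      simp [this]
    · have h := (mul_meas_ge_le_lintegral₀ hGm.restrict (ENNReal.ofReal K * A)).trans hint
      have h' : A * (ENNReal.ofReal K * volume.restrict Q {x | ENNReal.ofReal K * A < G x}) ≤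
          A * volume Q := by
        calc _ = ENNReal.ofReal K * A * volume.restrict Q {x | ENNReal.ofReal K * A < G x} := by
              ring
          _ ≤ ENNReal.ofReal K * A * volume.restrict Q {x | ENNReal.ofReal K * A ≤ G x} := by
              gcongr
              exact fun hx => le_of_lt hx
          _ ≤ _ := h.trans_eq (mul_comm _ _)
      exact (ENNReal.mul_le_mul_iff_right h0 hAt).1 h'
  refine ⟨(measurableSet_dyadicCube k m).nullMeasurableSet.inter hGnull, inter_subset_left, ?_⟩
  change ENNReal.ofReal ε * volume Q < volume (Q ∩ {x | G x ≤ ENNReal.ofReal K * A})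
  have hsplit := measure_inter_add_sdiff₀ (μ := volume) Q hGnull
  by_contra! hcon
  have hfin : volume (Q ∩ {x | G x ≤ ENNReal.ofReal K * A}) ≠ ∞ :=
    ne_top_of_le_ne_top hQt (measure_mono inter_subset_left)
  have hfin' : volume (Q \ {x | G x ≤ ENNReal.ofReal K * A}) ≠ ∞ :=
    ne_top_of_le_ne_top hQt (measure_mono sdiff_subset)
  generalize volume (Q ∩ {x | G x ≤ ENNReal.ofReal K * A}) = u at *
  generalize volume (Q \ {x | G x ≤ ENNReal.ofReal K * A}) = v at *
  generalize volume Q = w at *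
  lift u to NNReal using hfin
  lift v to NNReal using hfin'
  lift w to NNReal using hQt
  have hw : (0 : ℝ) < w := by
    have : w ≠ 0 := by simpa using hQ0
    positivity
  have e1 : (u : ℝ) + v = w := by exact_mod_cast hsplit
  have e2 : K * (v : ℝ) ≤ w := by
    have := ENNReal.toReal_mono ENNReal.coe_ne_top hcheb
    simpa [ENNReal.toReal_mul, hK.le] using this
  have e3 : (u : ℝ) ≤ ε * w := by
    have := ENNReal.toReal_mono
      (ENNReal.mul_ne_top ENNReal.ofReal_ne_top ENNReal.coe_ne_top) hcon
    simpa [ENNReal.toReal_mul, hε0.le] using this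
  -- If u ≤ εw then v ≥ (1 - ε)w, so Kv ≥ K(1 - ε)w > w, against Chebyshev.
  have e4 : K * ((1 - ε) * w) ≤ K * v := mul_le_mul_of_nonneg_left (by linarith) hK.le
  nlinarith

theorem collectionNorm_sublevel_le (hq : 0 < q) (lam : ℤ → (Fin n → ℤ) → ℂ) {K : ℝ} (hK : 0 < K) :
    collectionNorm q t lam (sublevel q t lam (ENNReal.ofReal K * fInftyNorm q t lam ^ q)) ≤
      ENNReal.ofReal (K ^ (1 / q)) * fInftyNorm q t lam := by
  refine essSup_le_of_ae_le _ (Filter.Eventually.of_forall fun x => ?_)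
  refine (ENNReal.rpow_le_rpow (tsum_levelSum_sublevel_le lam _ x)
    (by positivity : (0 : ℝ) ≤ 1 / q)).trans_eq ?_
  rw [ENNReal.mul_rpow_of_nonneg _ _ (by positivity), ENNReal.ofReal_rpow_of_pos hK,
    ← ENNReal.rpow_mul, mul_one_div_cancel hq.ne', ENNReal.rpow_one]

end WeightedTL

/-! ### The equivalence. -/

theorem mainTheorem8 {n : ℕ} {θ q : ℝ} (hθ : 0 < θ) (hθq : θ ≤ q)
    (t : ℤ → (Fin n → ℝ) → ℝ) (ht : WeightedTL.IsAdmissible q t)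
    (htA : WeightedTL.DiagonalCondition (ENNReal.ofReal q) (WeightedTL.sigmaOne θ q) t)
    (ε : ℝ) (hε0 : 0 < ε) (hε1 : ε < 1) :
    (∀ lam : ℤ → (Fin n → ℤ) → ℂ,
      lam ∈ WeightedTL.fInfty q t ↔
        ∃ E ∈ WeightedTL.subsetCollections n ε, WeightedTL.collectionNorm q t lam E < ∞) ∧
    ∃ c₁ c₂ : ℝ, 0 < c₁ ∧ 0 < c₂ ∧ ∀ lam : ℤ → (Fin n → ℤ) → ℂ,
      ENNReal.ofReal c₁ * WeightedTL.fInftyNorm q t lam ≤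
          (⨅ E ∈ WeightedTL.subsetCollections n ε, WeightedTL.collectionNorm q t lam E) ∧
        (⨅ E ∈ WeightedTL.subsetCollections n ε, WeightedTL.collectionNorm q t lam E) ≤
          ENNReal.ofReal c₂ * WeightedTL.fInftyNorm q t lam := by
  have hq : 0 < q := hθ.trans_le hθq
  obtain ⟨C, hC, hA⟩ := htA
  set M : ℝ := C * ε ^ (-(1 / θ))
  have hM : 0 < M := by positivity
  have hε : 0 < 1 - ε := sub_pos.2 hε1
  -- Any K > 1/(1 - ε) would do.
  set K : ℝ := 2 / (1 - ε) with hKdef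
  have hK : 0 < K := by positivity
  have hK1 : 1 < K * (1 - ε) := by
    rw [hKdef, div_mul_cancel₀ _ hε.ne']
    norm_num
  have lower : ∀ lam : ℤ → (Fin n → ℤ) → ℂ, ∀ E ∈ WeightedTL.subsetCollections n ε,
      WeightedTL.fInftyNorm q t lam ≤ ENNReal.ofReal M * WeightedTL.collectionNorm q t lam E :=
    fun lam E hE => WeightedTL.fInftyNorm_le_mul_collectionNorm hq ht hM (fun k m => (hE k m).1)
      (fun k m => (hE k m).2.1) fun k m => WeightedTL.lintegral_cube_le hθ hθq ht hε0 hC hA k _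
        (by positivity) (hE k m).1 (hE k m).2.1 (hE k m).2.2
  have upper : ∀ lam : ℤ → (Fin n → ℤ) → ℂ, WeightedTL.fInftyNorm q t lam ≠ ∞ →
      ∃ E ∈ WeightedTL.subsetCollections n ε, WeightedTL.collectionNorm q t lam E ≤
        ENNReal.ofReal (K ^ (1 / q)) * WeightedTL.fInftyNorm q t lam :=
    fun lam hlam => ⟨_, WeightedTL.sublevel_mem_subsetCollections hq ht hε0 hlam hK hK1,
      WeightedTL.collectionNorm_sublevel_le hq lam hK⟩
  refine ⟨fun lam => ⟨fun hlam => ?_, ?_⟩, M⁻¹, K ^ (1 / q), inv_pos.2 hM, by positivity,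
    fun lam => ⟨?_, ?_⟩⟩
  · have hlam' : WeightedTL.fInftyNorm q t lam < ∞ := hlam
    obtain ⟨E, hE, hle⟩ := upper lam hlam'.ne
    exact ⟨E, hE, hle.trans_lt (ENNReal.mul_lt_top ENNReal.ofReal_lt_top hlam')⟩
  · rintro ⟨E, hE, hfin⟩
    exact (lower lam E hE).trans_lt (ENNReal.mul_lt_top ENNReal.ofReal_lt_top hfin)
  · refine le_iInf₂ fun E hE => ?_
    rw [ENNReal.ofReal_inv_of_pos hM, mul_comm, ← div_eq_mul_inv]
    exact ENNReal.div_le_of_le_mul' (lower lam E hE)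
  -- The sublevel sets are used only for finite norm; otherwise the right side is ∞.
  · rcases eq_or_ne (WeightedTL.fInftyNorm q t lam) ∞ with h | h
    · rw [h, ENNReal.mul_top (by simpa using Real.rpow_pos_of_pos hK _)]
      exact le_top
    · obtain ⟨E, hE, hle⟩ := upper lam h
      exact (iInf₂_le E hE).trans hle
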